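/- For $\operatorname{Re} a>0$ let $\zeta(s,a)$ be the Hurwitz zeta function, i.e. the analytic continuation in $s$ to $\mathbb{C}\setminus\{1\}$ of $\sum_{n\ge 0}(n+a)^{-s}$ ($\operatorname{Re} s>1$), and let $\zeta'(s,a)=\partial\zeta(s,a)/\partial s$. Let $\psi=\Gamma'/\Gamma$ be the digamma function, $\gamma$ Euler's constant, and for $n=0,1,2,\dots$ put $$g(n,a)=\zeta'(-n,a)+\psi(n+1)\,\zeta(-n,a).$$ Let $\log\Gamma$ be the holomorphic branch of the logarithm of $\Gamma$ on the half-plane $\operatorname{Re} z>0$ with $\log\Gamma(1)=0$. **Theorem 4.** Let $a,t\in\mathbb{C}$ with $\operatorname{Re} a>0$ and $|t|<\operatorname{Re} a$; integrals from $0$ to $t$ are taken along the straight segment. Then for every integer $m\ge 0$ the integrand $s^m\log\Gamma(a+s)$ is integrable along this segment and $$\int_0^t s^m\log\Gamma(a+s)\,ds=-\gamma\,\frac{t^{m+2}}{m+2}+\Bigl[\log\sqrt{2\pi}-\gamma\bigl(a-\tfrac12\bigr)\Bigr]\frac{t^{m+1}}{m+1}+\sum_{k=0}^m\frac{(-1)^k}{k+1}\binom{m}{k}t^{m-k}\,g(k+1,a+t)-\frac{(-1)^m}{m+1}\,g(m+1,a).$$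 In particular, the case $m=0$ can be written as $$\int_0^t\log\Gamma(a+s)\,ds=-\frac{t^2}{2}+\Bigl(\log\sqrt{2\pi}-a+\tfrac12\Bigr)t+\zeta'(-1,a+t)-\zeta'(-1,a).$$ -/

import Mathlib

namespace HurwitzContinuation

open Complex Set Filter Topology

/-- The binomial coefficient `(-s choose k)`. -/
noncomputable def binomCoef : ℕ → ℂ → ℂ
  | 0, _ => 1
  | k + 1, s => binomCoef k s * (-(s + k) / (k + 1))

lemma coef_shift (k : ℕ) (s : ℂ) : ((k : ℂ) + 1) * binomCoef (k + 1) s = -s * binomCoef k (s + 1) := by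
  induction k with
  | zero => simp [binomCoef]
  | succ k ih =>
    have h1 : ((k : ℂ) + 1) ≠ 0 := by exact_mod_cast Nat.succ_ne_zero k
    have h2 : ((k : ℂ) + 1 + 1) ≠ 0 := by exact_mod_cast Nat.succ_ne_zero (k + 1)
    have e1 : binomCoef (k + 1 + 1) s = binomCoef (k + 1) s * (-(s + (k + 1 : ℕ)) / ((k + 1 : ℕ) + 1)) := rfl
    have e2 : binomCoef (k + 1) (s + 1) = binomCoef k (s + 1) * (-(s + 1 + k) / (k + 1)) := rfl
    rw [e1, e2]
    push_cast
    field_simp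
    linear_combination (-(s + (k + 1))) * ih

lemma differentiable_coef (k : ℕ) : Differentiable ℂ (binomCoef k) := by
  induction k with
  | zero => exact differentiable_const 1
  | succ k ih =>
    have : binomCoef (k + 1) = fun s => binomCoef k s * (-(s + k) / (k + 1)) := rfl
    rw [this]
    fun_prop

/-- Remainder of order `K` in the binomial expansion of `(n + 1 + z) ^ (-s)`. -/
noncomputable def binomRem (K n : ℕ) (s z : ℂ) : ℂ :=
  ((n : ℂ) + 1 + z) ^ (-s)
    - ∑ k ∈ Finset.range K, binomCoef k s * z ^ k * ((n : ℂ) + 1) ^ (-s - k)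

lemma rem_zero_right (K n : ℕ) (s : ℂ) : binomRem (K + 1) n s 0 = 0 := by
  simp [binomRem, Finset.sum_range_succ', binomCoef]

lemma hasDerivAt_rem (K n : ℕ) (s z : ℂ) (hz : 0 ≤ z.re) :
    HasDerivAt (binomRem (K + 1) n s) (-s * binomRem K n (s + 1) z) z := by
  have hsp : (n : ℂ) + 1 + z ∈ slitPlane := by
    left; simp; positivity
  have h1 : HasDerivAt (fun z : ℂ => ((n : ℂ) + 1 + z) ^ (-s))
      (-s * ((n : ℂ) + 1 + z) ^ (-s - 1) * 1) z :=
    HasDerivAt.cpow_const ((hasDerivAt_id z).const_add _) hsp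
  have h2 : ∀ k ∈ Finset.range K, HasDerivAt
      (fun z : ℂ => binomCoef (k + 1) s * z ^ (k + 1) * ((n : ℂ) + 1) ^ (-s - (k + 1 : ℕ)))
      (binomCoef (k + 1) s * (((k + 1 : ℕ) : ℂ) * z ^ k) * ((n : ℂ) + 1) ^ (-s - (k + 1 : ℕ))) z := by
    intro k _
    exact ((hasDerivAt_pow (k + 1) z).const_mul _).mul_const _
  have h3 := h1.sub ((HasDerivAt.fun_sum h2).add_const (((n : ℂ) + 1) ^ (-s)))
  refine (h3.congr_deriv ?_).congr_of_eventuallyEq (Eventually.of_forall fun z => ?_)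
  rotate_left
  · simp [binomRem, Finset.sum_range_succ', binomCoef]
  · rw [binomRem, mul_sub, Finset.mul_sum, mul_one]
    congr 1
    · congr 2; ring
    · refine Finset.sum_congr rfl fun k _ => ?_
      have := coef_shift k s
      have e : -(s + 1) - (k : ℂ) = -s - ((k + 1 : ℕ) : ℂ) := by push_cast; ring
      rw [e]
      push_cast
      linear_combination ((z ^ k * ((n : ℂ) + 1) ^ (-s - ((k : ℂ) + 1)))) * this

lemma rem_zero_bound (A M : ℝ) (hA : 0 ≤ A) (hM : 0 ≤ M) :
    ∃ C : ℝ, 0 ≤ C ∧ ∀ (n : ℕ) (s z : ℂ), ‖s‖ ≤ M → 0 ≤ z.re → ‖z‖ ≤ A →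
      ‖binomRem 0 n s z‖ ≤ C * ((n : ℝ) + 1) ^ (-s.re) := by
  refine ⟨(1 + A) ^ M * Real.exp (Real.pi * M), by positivity, fun n s z hs hz hzA => ?_⟩
  have hw : binomRem 0 n s z = ((n : ℂ) + 1 + z) ^ (-s) := by simp [binomRem]
  have hN : (1 : ℝ) ≤ (n : ℝ) + 1 := by linarith [n.cast_nonneg (α := ℝ)]
  have hlow : (n : ℝ) + 1 ≤ ‖(n : ℂ) + 1 + z‖ := by
    refine le_trans ?_ (re_le_norm _)
    simp [hz]
  have hup : ‖(n : ℂ) + 1 + z‖ ≤ ((n : ℝ) + 1) * (1 + A) := by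
    have h : ‖(n : ℂ) + 1‖ = (n : ℝ) + 1 := by
      rw [← Nat.cast_succ, norm_natCast]; simp
    have := norm_add_le ((n : ℂ) + 1) z
    nlinarith
  set w := (n : ℂ) + 1 + z
  have hN0 : (0 : ℝ) < (n : ℝ) + 1 := by linarith
  have hre : |s.re| ≤ M := (abs_re_le_norm s).trans hs
  have him : |s.im| ≤ M := (abs_im_le_norm s).trans hs
  obtain ⟨r, hr, hr1, hrA⟩ : ∃ r : ℝ, ‖w‖ = ((n : ℝ) + 1) * r ∧ 1 ≤ r ∧ r ≤ 1 + A := by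
    refine ⟨‖w‖ / ((n : ℝ) + 1), by field_simp, ?_, ?_⟩
    · rw [le_div_iff₀ hN0]; linarith
    · rw [div_le_iff₀ hN0]; linarith
  rw [hw]
  refine (norm_cpow_le _ _).trans ?_
  rw [div_eq_mul_inv, ← Real.exp_neg, hr, Real.mul_rpow hN0.le (by linarith)]
  have b1 : r ^ (-s).re ≤ (1 + A) ^ M := by
    calc r ^ (-s).re ≤ r ^ M := by
          apply Real.rpow_le_rpow_of_exponent_le hr1
          simp; linarith [neg_abs_le s.re]
      _ ≤ (1 + A) ^ M := Real.rpow_le_rpow (by linarith) hrA hM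
  have b2 : Real.exp (-(arg w * (-s).im)) ≤ Real.exp (Real.pi * M) := by
    apply Real.exp_le_exp.mpr
    have : |arg w * s.im| ≤ Real.pi * M := by
      rw [abs_mul]
      exact mul_le_mul (abs_arg_le_pi w) him (abs_nonneg _) Real.pi_pos.le
    simpa using (le_abs_self _).trans this
  have e : (-s).re = -s.re := by simp
  rw [e] at b1 ⊢
  calc ((n : ℝ) + 1) ^ (-s.re) * r ^ (-s.re) * Real.exp (-(arg w * (-s).im))
      ≤ ((n : ℝ) + 1) ^ (-s.re) * (1 + A) ^ M * Real.exp (Real.pi * M) := by gcongr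
    _ = _ := by ring

lemma rem_bound (K : ℕ) : ∀ (A M : ℝ) (_ : 0 ≤ A) (_ : 0 ≤ M),
    ∃ C : ℝ, 0 ≤ C ∧ ∀ (n : ℕ) (s z : ℂ), ‖s‖ ≤ M → 0 ≤ z.re → ‖z‖ ≤ A →
      ‖binomRem K n s z‖ ≤ C * ((n : ℝ) + 1) ^ (-s.re - K) := by
  induction K with
  | zero => simpa using rem_zero_bound
  | succ K ih =>
    intro A M hA hM
    obtain ⟨C, hC, h⟩ := ih A (M + 1) hA (by linarith)
    refine ⟨M * C * A, by positivity, fun n s z hs hz hzA => ?_⟩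
    have hconv : Convex ℝ ({z : ℂ | 0 ≤ z.re} ∩ Metric.closedBall 0 A) :=
      (convex_halfSpace_re_ge 0).inter (convex_closedBall 0 A)
    have key := hconv.norm_image_sub_le_of_norm_hasDerivWithin_le
      (f := binomRem (K + 1) n s) (f' := fun z => -s * binomRem K n (s + 1) z)
      (C := M * (C * ((n : ℝ) + 1) ^ (-s.re - (K + 1 : ℕ)))) (x := 0) (y := z)
      (fun x hx => (hasDerivAt_rem K n s x hx.1).hasDerivWithinAt)
      (fun x hx => by
        rw [norm_mul, norm_neg]
        have h1 : ‖s + 1‖ ≤ M + 1 := (norm_add_le _ _).trans (by simpa using hs)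
        have h2 := h n (s + 1) x h1 hx.1 (by simpa using hx.2)
        have e : -(s + 1).re - (K : ℝ) = -s.re - (K + 1 : ℕ) := by
          push_cast; simp; ring
        rw [e] at h2
        gcongr)
      ⟨by simp, by simpa using hA⟩ ⟨hz, by simpa using hzA⟩
    rw [rem_zero_right, sub_zero, sub_zero] at key
    refine key.trans ?_
    have : 0 ≤ M * (C * ((n : ℝ) + 1) ^ (-s.re - (K + 1 : ℕ))) := by positivity
    calc _ ≤ M * (C * ((n : ℝ) + 1) ^ (-s.re - (K + 1 : ℕ))) * A := by gcongr
      _ = _ := by ring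

lemma summable_aux {p : ℝ} (hp : 1 < p) : Summable fun n : ℕ => ((n : ℝ) + 1) ^ (-p) := by
  have := (summable_nat_add_iff 1).mpr (Real.summable_nat_rpow.mpr (show -p < -1 by linarith))
  simpa using this

lemma summable_rem (K : ℕ) (s z : ℂ) (hz : 0 ≤ z.re) (hs : 1 - K < s.re) :
    Summable fun n => binomRem K n s z := by
  obtain ⟨C, _, h⟩ := rem_bound K ‖z‖ ‖s‖ (norm_nonneg _) (norm_nonneg _)
  refine Summable.of_norm_bounded ((summable_aux (p := s.re + K) (by linarith)).mul_left C)
    fun n => ?_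
  have := h n s z le_rfl hz le_rfl
  rwa [neg_add, ← sub_eq_add_neg]

lemma differentiable_rem (K n : ℕ) (z : ℂ) (hz : 0 ≤ z.re) :
    Differentiable ℂ fun s => binomRem K n s z := by
  have h1 : (n : ℂ) + 1 + z ≠ 0 := by
    intro h
    have := congrArg re h
    simp at this
    linarith [n.cast_nonneg (α := ℝ)]
  have h2 : (n : ℂ) + 1 ≠ 0 := by exact_mod_cast Nat.succ_ne_zero n
  unfold binomRem
  refine Differentiable.sub ?_ (Differentiable.fun_sum fun k _ => ?_)
  · exact fun s => (differentiableAt_id.neg).const_cpow (Or.inl h1)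
  · refine ((differentiable_coef k).mul_const _).mul fun s => ?_
    exact (differentiableAt_id.neg.sub_const _).const_cpow (Or.inl h2)

lemma differentiableOn_tsum_rem (K : ℕ) (z : ℂ) (hz : 0 ≤ z.re) :
    DifferentiableOn ℂ (fun s => ∑' n, binomRem K n s z) {s | 1 - (K : ℝ) < s.re} := by
  intro s₀ hs₀
  simp only [mem_ofPred_eq] at hs₀
  set p : ℝ := (s₀.re + (1 - K)) / 2 with hp
  set U : Set ℂ := {s | p < s.re} ∩ Metric.ball 0 (‖s₀‖ + 1)
  have hU : IsOpen U := (isOpen_lt continuous_const continuous_re).inter Metric.isOpen_ball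
  have hmem : s₀ ∈ U := ⟨by simp only [mem_ofPred_eq]; linarith, by simp⟩
  obtain ⟨C, hC, h⟩ := rem_bound K ‖z‖ (‖s₀‖ + 1) (norm_nonneg _) (by positivity)
  have := differentiableOn_tsum_of_summable_norm (F := fun n s => binomRem K n s z) (U := U)
    ((summable_aux (p := p + K) (by linarith)).mul_left C)
    (fun n => (differentiable_rem K n z hz).differentiableOn) hU
    (fun n s hs => by
      refine (h n s z ?_ hz le_rfl).trans ?_
      · simpa using (mem_ball_zero_iff.mp hs.2).le
      · gcongr
        · linarith [n.cast_nonneg (α := ℝ)]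
        · have : p < s.re := hs.1
          linarith)
  exact (this.differentiableAt (hU.mem_nhds hmem)).differentiableWithinAt

lemma exists_entire_zeta :
    ∃ Z : ℂ → ℂ, Differentiable ℂ Z ∧ ∀ s, s ≠ 1 → Z s = (s - 1) * riemannZeta s := by
  refine ⟨Function.update (fun s => (s - 1) * riemannZeta s) 1 1, ?_, fun s hs => by simp [hs]⟩
  rw [← differentiableOn_univ,
    ← differentiableOn_compl_singleton_and_continuousAt_iff (c := 1) univ_mem]
  constructor
  · refine DifferentiableOn.congr (f := fun s => (s - 1) * riemannZeta s) ?_ ?_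
    · intro s hs
      exact ((differentiableAt_id.sub_const _).mul
        (differentiableAt_riemannZeta hs.2)).differentiableWithinAt
    · intro s hs
      simp [show s ≠ 1 from hs.2]
  · rw [continuousAt_update_same]
    exact riemannZeta_residue_one

/-- Continuation to a half plane. -/
lemma exists_halfPlane (K : ℕ) (z : ℂ) (hz : 0 ≤ z.re) :
    ∃ E : ℂ → ℂ, DifferentiableOn ℂ E {s | 1 - (K : ℝ) < s.re} ∧
      ∀ s : ℂ, 1 < s.re → E s = (s - 1) * ∑' n : ℕ, ((n : ℂ) + 1 + z) ^ (-s) := by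
  obtain ⟨Z, hZ, hZ'⟩ := exists_entire_zeta
  induction K with
  | zero =>
    refine ⟨fun s => (s - 1) * ∑' n : ℕ, binomRem 0 n s z, ?_, fun s _ => by simp [binomRem]⟩
    exact (differentiableOn_id.sub_const _).mul (differentiableOn_tsum_rem 0 z hz)
  | succ K _ =>
    refine ⟨fun s => (s - 1) * ∑' n : ℕ, binomRem (K + 1) n s z
      + (Z s + (s - 1) * ∑ k ∈ Finset.range K,
        (-binomCoef k s / (k + 1)) * z ^ (k + 1) * Z (s + (k + 1 : ℕ))), ?_, fun s hs => ?_⟩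
    · refine ((differentiableOn_id.sub_const _).mul (differentiableOn_tsum_rem (K + 1) z hz)).add
        (Differentiable.differentiableOn ?_)
      refine hZ.add ((differentiable_id.sub_const _).mul (Differentiable.fun_sum fun k _ => ?_))
      exact (((differentiable_coef k).neg.div_const _).mul_const _).mul
        (hZ.comp (differentiable_id.add_const _))
    · have hs1 : s ≠ 1 := by rintro rfl; simp at hs
      have hsum0 := summable_rem 0 s z hz (by simpa using hs)
      have hz1 : ∀ k : ℕ, HasSum (fun n : ℕ => ((n : ℂ) + 1) ^ (-s - k)) (riemannZeta (s + k)) := by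
        intro k
        have hk : 1 < (s + k).re := by simp; linarith [k.cast_nonneg (α := ℝ)]
        have h1 := zeta_eq_tsum_one_div_nat_add_one_cpow hk
        have h2 := summable_rem 0 (s + k) 0 (by simp) (by simpa using hk)
        have e : ∀ n : ℕ, ((n : ℂ) + 1) ^ (-s - k) = 1 / ((n : ℂ) + 1) ^ (s + k) := by
          intro n
          rw [one_div, ← cpow_neg]; congr 1; ring
        simp only [e, h1]
        refine Summable.hasSum ?_
        refine h2.congr fun n => ?_
        simp [binomRem, cpow_neg, -neg_add_rev]
      have hsumR : ∑' n : ℕ, binomRem (K + 1) n s z = (∑' n : ℕ, ((n : ℂ) + 1 + z) ^ (-s))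
          - ∑ k ∈ Finset.range (K + 1), binomCoef k s * z ^ k * riemannZeta (s + k) := by
        have h0 : Summable fun n : ℕ => ((n : ℂ) + 1 + z) ^ (-s) := by simpa [binomRem] using hsum0
        exact (h0.hasSum.sub (hasSum_sum fun k _ => (hz1 k).mul_left _)).tsum_eq
      simp only [hsumR, Finset.sum_range_succ', hZ' s hs1]
      have hk : ∀ k ∈ Finset.range K, -binomCoef k s / (k + 1) * z ^ (k + 1) * Z (s + (k + 1 : ℕ))
          = binomCoef (k + 1) s * z ^ (k + 1) * riemannZeta (s + (k + 1 : ℕ)) := by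
        intro k _
        have hne : s + ((k + 1 : ℕ) : ℂ) ≠ 1 := by
          intro h
          have := congrArg re h
          simp at this
          linarith [k.cast_nonneg (α := ℝ)]
        rw [hZ' _ hne]
        have e2 : binomCoef (k + 1) s = binomCoef k s * (-(s + k) / (k + 1)) := rfl
        rw [e2]
        push_cast
        ring
      rw [Finset.sum_congr rfl hk]
      simp [binomCoef]
      ring

lemma exists_entire (z : ℂ) (hz : 0 ≤ z.re) :
    ∃ E : ℂ → ℂ, Differentiable ℂ E ∧
      ∀ s : ℂ, 1 < s.re → E s = (s - 1) * ∑' n : ℕ, ((n : ℂ) + 1 + z) ^ (-s) := by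
  choose E hE hE' using fun K => exists_halfPlane K z hz
  have hopen : ∀ c : ℝ, IsOpen {s : ℂ | c < s.re} := fun c =>
    isOpen_lt continuous_const continuous_re
  have hagree : ∀ K L : ℕ, K ≤ L → ∀ s : ℂ, 1 - (K : ℝ) < s.re → E K s = E L s := by
    intro K L hKL s hs
    have hL : {s : ℂ | 1 - (K : ℝ) < s.re} ⊆ {s | 1 - (L : ℝ) < s.re} := by
      intro s hs
      have : (K : ℝ) ≤ L := by exact_mod_cast hKL
      simp only [mem_ofPred_eq] at hs ⊢
      linarith
    refine AnalyticOnNhd.eqOn_of_preconnected_of_eventuallyEq (𝕜 := ℂ)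
      ((hE K).analyticOnNhd (hopen _)) (((hE L).mono hL).analyticOnNhd (hopen _))
      (convex_halfSpace_re_gt _).isPreconnected (z₀ := 2) ?_ ?_ hs
    · simp; linarith [K.cast_nonneg (α := ℝ)]
    · filter_upwards [(hopen 1).mem_nhds (show (2 : ℂ) ∈ {s : ℂ | 1 < s.re} by simp)] with w hw
      rw [hE' K w hw, hE' L w hw]
  have hidx : ∀ s : ℂ, ∃ K : ℕ, 1 - (K : ℝ) < s.re := fun s => by
    obtain ⟨K, hK⟩ := exists_nat_gt (1 - s.re)
    exact ⟨K, by linarith⟩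
  choose N hN using hidx
  refine ⟨fun s => E (N s) s, fun s₀ => ?_, fun s hs => hE' _ s hs⟩
  have hd : DifferentiableAt ℂ (E (N s₀)) s₀ :=
    (hE (N s₀)).differentiableAt ((hopen _).mem_nhds (hN s₀))
  refine hd.congr_of_eventuallyEq ?_
  filter_upwards [(hopen _).mem_nhds (hN s₀)] with s hs
  rcases le_total (N s) (N s₀) with h | h
  · exact hagree _ _ h s (hN s)
  · exact (hagree _ _ h s hs).symm

/-- For `0 < re a`, the series `∑ (n + a) ^ (-s)` has an analytic continuation to `s ≠ 1`. -/
theorem exists_continuation (a : ℂ) (ha : 0 < a.re) :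
    ∃ f : ℂ → ℂ, DifferentiableOn ℂ f {1}ᶜ ∧
      ∀ s : ℂ, 1 < s.re → HasSum (fun n : ℕ => 1 / ((n : ℂ) + a) ^ s) (f s) := by
  obtain ⟨E, hE, hE'⟩ := exists_entire a ha.le
  have ha0 : a ≠ 0 := by rintro rfl; simp at ha
  refine ⟨fun s => a ^ (-s) + E s / (s - 1), fun s hs => ?_, fun s hs => ?_⟩
  · have hs1 : s - 1 ≠ 0 := sub_ne_zero.mpr hs
    refine DifferentiableAt.differentiableWithinAt ?_
    exact (differentiableAt_id.neg.const_cpow (Or.inl ha0)).add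
      ((hE s).div (differentiableAt_id.sub_const _) hs1)
  · have hs1 : s - 1 ≠ 0 := by
      intro h
      rw [sub_eq_zero.mp h] at hs; simp at hs
    have hsum : Summable fun n : ℕ => ((n : ℂ) + 1 + a) ^ (-s) := by
      simpa [binomRem] using summable_rem 0 s a ha.le (by simpa using hs)
    change HasSum _ (a ^ (-s) + E s / (s - 1))
    rw [hE' s hs, mul_div_cancel_left₀ _ hs1, ← hasSum_nat_add_iff' 1]
    simpa [cpow_neg, add_assoc] using hsum.hasSum

end HurwitzContinuation

/-- The Hurwitz zeta function `ζ(s, a)` for `0 < re a`, `s ≠ 1`: the analytic continuation in `s`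
of `∑ n, 1 / (n + a) ^ s` (`1 < re s`) to `ℂ \ {1}`, which is unique since `ℂ \ {1}` is
connected. -/
noncomputable def hurwitzZetaC (s a : ℂ) : ℂ :=
  open Classical in
  if ha : 0 < a.re then Classical.choose (HurwitzContinuation.exists_continuation a ha) s else 0

/-- The derivative `ζ'(s, a) = ∂ζ(s, a)/∂s` in the first variable. -/
noncomputable def hurwitzZetaCDeriv (s a : ℂ) : ℂ :=
  deriv (fun w => hurwitzZetaC w a) s

/-- The holomorphic branch of `log Γ` on `0 < re z` with `log Γ(1) = 0`, i.e. the primitive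
of `ψ = Γ'/Γ` vanishing at `1`, as the integral of `ψ` along the segment from `1` to `z`. It is
real on the positive reals. -/
noncomputable def logGamma (z : ℂ) : ℂ :=
  ∫ u in (0 : ℝ)..1, Complex.digamma (1 + (u : ℂ) * (z - 1)) * (z - 1)

/-- `g(n, a) = ζ'(-n, a) + ψ(n + 1) ζ(-n, a)`. -/
noncomputable def gFun (n : ℕ) (a : ℂ) : ℂ :=
  hurwitzZetaCDeriv (-(n : ℂ)) a + Complex.digamma ((n : ℂ) + 1) * hurwitzZetaC (-(n : ℂ)) a

/-- `∫_0^t f(s) ds` along the straight segment from `0` to `t` in `ℂ`. -/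
noncomputable def segmentIntegral (f : ℂ → ℂ) (t : ℂ) : ℂ :=
  ∫ u in (0 : ℝ)..1, f ((u : ℂ) * t) * t

namespace HurwitzContinuation

open Complex Set Filter Topology

/-! The right-hand side, as a function of `t`, is a primitive of the integrand along the segment,
and its value at `0` is the last term. Two facts make this work.

The first is the ladder `g(k+1, ·)' = (k+1) g(k, ·)` (`hasDerivAt_gFun`). From `∂ζ(s, z)/∂z = -s
ζ(s+1, z)`, differentiating in `s` at `s = -(k+1)` leaves an extra `-ζ(-k, z)`, and the recurrence
`ψ(k+2) = ψ(k+1) + 1/(k+1)` cancels it; this is why `g` carries the digamma term. With the ladder,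
the derivative of the alternating binomial sum telescopes to `t^m g(0, a+t)`
(`hasDerivAt_sum_gFun`).

The second is Lerch's formula (`logGamma_eq`) with `ζ(0, z) = 1/2 - z`. Together they express `g(0,
z)` as `log Γ(z)` plus an affine function of `z`, and the two polynomial terms integrate that affine
function away.

The analysis rests on an expansion of `ζ(s, z)` in powers of `z` with a uniformly controlled
remainder (`hurwitzZetaC_eq_expansion`). It yields the `z`-derivative, joint continuity and the
behaviour at `s = 0`. The mixed derivative is handled by writing `∂/∂s` as a Cauchy integral and
differentiating under it. -/

/-! ### Characterisation of the Hurwitz zeta function by its Dirichlet series. -/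

lemma differentiableOn_hurwitzZetaC {a : ℂ} (ha : 0 < a.re) :
    DifferentiableOn ℂ (fun s => hurwitzZetaC s a) {1}ᶜ := by
  have h := (Classical.choose_spec (exists_continuation a ha)).1
  simpa only [hurwitzZetaC, dif_pos ha] using h

lemma hasSum_hurwitzZetaC {a s : ℂ} (ha : 0 < a.re) (hs : 1 < s.re) :
    HasSum (fun n : ℕ => 1 / ((n : ℂ) + a) ^ s) (hurwitzZetaC s a) := by
  have h := (Classical.choose_spec (exists_continuation a ha)).2 s hs
  simpa only [hurwitzZetaC, dif_pos ha] using h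

lemma differentiableAt_hurwitzZetaC {a s : ℂ} (ha : 0 < a.re) (hs : s ≠ 1) :
    DifferentiableAt ℂ (fun s => hurwitzZetaC s a) s :=
  (differentiableOn_hurwitzZetaC ha).differentiableAt (isOpen_compl_singleton.mem_nhds hs)

lemma ne_one_of_one_lt_re {s : ℂ} (hs : 1 < s.re) : s ≠ 1 := by
  rintro rfl; simp at hs

lemma isOpen_lt_re (c : ℝ) : IsOpen {s : ℂ | c < s.re} :=
  isOpen_lt continuous_const continuous_re

/-- Uniqueness of the analytic continuation. -/
lemma eq_hurwitzZetaC {a : ℂ} (ha : 0 < a.re) {f : ℂ → ℂ} (hf : DifferentiableOn ℂ f {1}ᶜ)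
    (h : ∀ s : ℂ, 1 < s.re → f s = hurwitzZetaC s a) {s : ℂ} (hs : s ≠ 1) :
    f s = hurwitzZetaC s a := by
  refine AnalyticOnNhd.eqOn_of_preconnected_of_eventuallyEq (𝕜 := ℂ)
    (hf.analyticOnNhd isOpen_compl_singleton)
    ((differentiableOn_hurwitzZetaC ha).analyticOnNhd isOpen_compl_singleton)
    (isConnected_compl_singleton_of_one_lt_rank (by simp) 1).isPreconnected (z₀ := 2)
    (by simp) ?_ hs
  filter_upwards [(isOpen_lt_re 1).mem_nhds (show (2 : ℂ) ∈ {s : ℂ | 1 < s.re} by simp)] with w hw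
  exact h w hw

lemma hurwitzZetaC_one_right {s : ℂ} (hs : s ≠ 1) : hurwitzZetaC s 1 = riemannZeta s := by
  refine (eq_hurwitzZetaC (by simp) (fun s hs => (differentiableAt_riemannZeta
    hs).differentiableWithinAt) (fun s hs => ?_) hs).symm
  rw [zeta_eq_tsum_one_div_nat_add_one_cpow hs]
  exact (hasSum_hurwitzZetaC (by simp) hs).tsum_eq

/-! ### Expansion in powers of the second variable. -/

/-- The entire continuation of `(-s choose k) ζ(s + k)` for `1 ≤ k`, and `ζ` itself for `k = 0`. -/
noncomputable def zetaCoef : ℕ → ℂ → ℂ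
  | 0, s => riemannZeta s
  | k + 1, s => -binomCoef k s / (k + 1) * riemannZeta₁ (s + (k + 1 : ℕ))

lemma riemannZeta₁_eq {s : ℂ} (hs : s ≠ 1) : riemannZeta₁ s = (s - 1) * riemannZeta s := by
  have : s - 1 ≠ 0 := sub_ne_zero.mpr hs
  rw [riemannZeta_eq_inv_sub_mul hs]
  field_simp

lemma zetaCoef_eq (k : ℕ) {s : ℂ} (hs : 1 < s.re) :
    zetaCoef k s = binomCoef k s * riemannZeta (s + k) := by
  cases k with
  | zero => simp [zetaCoef, binomCoef]
  | succ k =>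
    have hne : s + ((k + 1 : ℕ) : ℂ) ≠ 1 := by
      apply ne_one_of_one_lt_re
      simp
      linarith [k.cast_nonneg (α := ℝ)]
    have e2 : binomCoef (k + 1) s = binomCoef k s * (-(s + k) / (k + 1)) := rfl
    rw [zetaCoef, riemannZeta₁_eq hne, e2]
    push_cast
    ring

/-- The coefficient form of `∂ζ/∂z = -s ζ(s+1, z)`. At `s = 0` it fails for `k = 0`: the pole of
`ζ(s+1)` makes the left side `-1`. -/
lemma zetaCoef_shift (k : ℕ) {s : ℂ} (hs : s ≠ 0) :
    ((k : ℂ) + 1) * zetaCoef (k + 1) s = -s * zetaCoef k (s + 1) := by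
  have hk : ((k : ℂ) + 1) ≠ 0 := by exact_mod_cast Nat.succ_ne_zero k
  cases k with
  | zero =>
    have hne : s + 1 ≠ 1 := by simpa using hs
    simp [zetaCoef, binomCoef, riemannZeta₁_eq hne]
  | succ k =>
    have hk' : ((k : ℂ) + 1) ≠ 0 := by exact_mod_cast Nat.succ_ne_zero k
    have h := coef_shift k s
    simp only [zetaCoef]
    have e : s + 1 + ((k + 1 : ℕ) : ℂ) = s + ((k + 1 + 1 : ℕ) : ℂ) := by push_cast; ring
    rw [e]
    generalize riemannZeta₁ _ = y
    push_cast at hk ⊢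
    field_simp
    linear_combination (-y) * h

lemma differentiableAt_zetaCoef (k : ℕ) {s : ℂ} (hs : s ≠ 1) :
    DifferentiableAt ℂ (zetaCoef k) s := by
  cases k with
  | zero => exact differentiableAt_riemannZeta hs
  | succ k =>
    have h1 : DifferentiableAt ℂ (binomCoef k) s := differentiable_coef k s
    have : zetaCoef (k + 1) =
      fun s => -binomCoef k s / (k + 1) * riemannZeta₁ (s + (k + 1 : ℕ)) := rfl
    rw [this]
    fun_prop

lemma hasSum_riemannZeta_shift {s : ℂ} (hs : 1 < s.re) (k : ℕ) :
    HasSum (fun n : ℕ => ((n : ℂ) + 1) ^ (-s - k)) (riemannZeta (s + k)) := by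
  have hk : 1 < (s + k).re := by simp; linarith [k.cast_nonneg (α := ℝ)]
  have h := hasSum_hurwitzZetaC (a := 1) (by simp) hk
  rw [hurwitzZetaC_one_right (ne_one_of_one_lt_re hk)] at h
  refine h.congr_fun ?_
  intro n
  rw [one_div, ← cpow_neg]; congr 1; ring

/-- Expansion of `ζ(s, z)` in powers of `z` to order `K`. -/
lemma hurwitzZetaC_eq_expansion (K : ℕ) {s z : ℂ} (hz : 0 < z.re) (hs1 : s ≠ 1)
    (hs : -(K : ℝ) < s.re) :
    hurwitzZetaC s z = z ^ (-s) + ∑' n : ℕ, binomRem (K + 1) n s z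
      + ∑ k ∈ Finset.range (K + 1), zetaCoef k s * z ^ k := by
  obtain ⟨E, hE, hE'⟩ := exists_entire z hz.le
  have hz0 : z ≠ 0 := by rintro rfl; simp at hz
  have hcast : -(K : ℝ) = 1 - ((K + 1 : ℕ) : ℝ) := by push_cast; ring
  have key : ∀ s, s ≠ 1 → z ^ (-s) + E s / (s - 1) = hurwitzZetaC s z := by
    intro s hs
    refine eq_hurwitzZetaC (f := fun s => z ^ (-s) + E s / (s - 1)) hz (fun s hs => ?_)
      (fun s hs => ?_) hs
    · have hs1 : s - 1 ≠ 0 := sub_ne_zero.mpr hs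
      refine DifferentiableAt.differentiableWithinAt ?_
      exact (differentiableAt_id.neg.const_cpow (Or.inl hz0)).add
        ((hE s).div (differentiableAt_id.sub_const _) hs1)
    · have hs1 : s - 1 ≠ 0 := sub_ne_zero.mpr (ne_one_of_one_lt_re hs)
      have h := hasSum_hurwitzZetaC hz hs
      rw [← hasSum_nat_add_iff' 1] at h
      have e := h.tsum_eq
      simp only [hE' s hs, mul_div_cancel_left₀ _ hs1]
      simp only [Finset.sum_range_one, Nat.cast_add, Nat.cast_one, Nat.cast_zero, zero_add,
        one_div, ← cpow_neg] at e
      rw [e]; ring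
  -- The factor `s - 1` clears the pole, so both sides are analytic on the whole half-plane; it
  -- suffices to compare them near `2`, where the series converge.
  have hEs : E s = (s - 1) * ∑' n : ℕ, binomRem (K + 1) n s z
      + (riemannZeta₁ s + (s - 1) * ∑ k ∈ Finset.range K, zetaCoef (k + 1) s * z ^ (k + 1)) := by
    have hd : DifferentiableOn ℂ (fun s => (s - 1) * ∑' n : ℕ, binomRem (K + 1) n s z
      + (riemannZeta₁ s + (s - 1) * ∑ k ∈ Finset.range K, zetaCoef (k + 1) s * z ^ (k + 1)))
        {s | -(K : ℝ) < s.re} := by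
      have h1 := differentiableOn_tsum_rem (K + 1) z hz.le
      rw [← hcast] at h1
      refine ((differentiableOn_id.sub_const _).mul h1).add (Differentiable.differentiableOn ?_)
      refine differentiable_riemannZeta₁.add
        ((differentiable_id.sub_const _).mul (Differentiable.fun_sum fun k _ => ?_))
      exact (((differentiable_coef k).neg.div_const _).mul
        (differentiable_riemannZeta₁.comp (differentiable_id.add_const _))).mul_const _
    refine AnalyticOnNhd.eqOn_of_preconnected_of_eventuallyEq (𝕜 := ℂ)
      (hE.differentiableOn.analyticOnNhd (isOpen_lt_re _)) (hd.analyticOnNhd (isOpen_lt_re _))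
      (convex_halfSpace_re_gt _).isPreconnected (z₀ := 2) ?_ ?_ hs
    · simp; linarith [K.cast_nonneg (α := ℝ)]
    · filter_upwards [(isOpen_lt_re 1).mem_nhds
        (show (2 : ℂ) ∈ {s : ℂ | 1 < s.re} by simp)] with w hw
      have hw : 1 < w.re := hw
      have h0 : Summable fun n : ℕ => ((n : ℂ) + 1 + z) ^ (-w) := by
        simpa [binomRem] using summable_rem 0 w z hz.le (by simpa using hw)
      have hR : ∑' n : ℕ, binomRem (K + 1) n w z = (∑' n : ℕ, ((n : ℂ) + 1 + z) ^ (-w))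
          - ∑ k ∈ Finset.range (K + 1), zetaCoef k w * z ^ k := by
        simp only [zetaCoef_eq _ hw, mul_right_comm _ (riemannZeta _)]
        exact (h0.hasSum.sub (hasSum_sum fun k _ =>
          (hasSum_riemannZeta_shift hw k).mul_left _)).tsum_eq
      rw [hE' w hw, hR, Finset.sum_range_succ', riemannZeta₁_eq (ne_one_of_one_lt_re hw)]
      simp only [zetaCoef, pow_zero, mul_one]
      ring
  have hs1' : s - 1 ≠ 0 := sub_ne_zero.mpr hs1
  rw [← key s hs1, hEs, riemannZeta₁_eq hs1, Finset.sum_range_succ']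
  simp only [zetaCoef, pow_zero, mul_one]
  field_simp
  ring

/-! ### Derivative in the second variable and joint continuity. -/

/-- `∂ζ(s, z)/∂z = -s ζ(s + 1, z)`. -/
lemma hasDerivAt_hurwitzZetaC {s z : ℂ} (hz : 0 < z.re) (hs0 : s ≠ 0) (hs1 : s ≠ 1) :
    HasDerivAt (fun z => hurwitzZetaC s z) (-s * hurwitzZetaC (s + 1) z) z := by
  obtain ⟨K, hK⟩ := exists_nat_gt (-s.re)
  have hK : -((K : ℝ)) < s.re := by linarith
  have hz0 : z ∈ slitPlane := Or.inl hz
  have e2 := hurwitzZetaC_eq_expansion (K + 1) hz hs1 (by push_cast; linarith)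
  -- Differentiation lowers the remainder's order by one and raises `s` by one, so the decay
  -- exponent in `n` is unchanged. Hence order `K + 1` at `s` matches order `K` at `s + 1`.
  have hrem : HasDerivAt (fun z => ∑' n : ℕ, binomRem (K + 1 + 1) n s z)
      (∑' n : ℕ, -s * binomRem (K + 1) n (s + 1) z) z := by
    obtain ⟨C, hC, h⟩ := rem_bound (K + 1) (‖z‖ + 1) ‖s + 1‖ (by positivity) (norm_nonneg _)
    have hV : IsOpen ({z : ℂ | 0 < z.re} ∩ Metric.ball 0 (‖z‖ + 1)) :=
      (isOpen_lt_re 0).inter Metric.isOpen_ball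
    have hmem : z ∈ {z : ℂ | 0 < z.re} ∩ Metric.ball 0 (‖z‖ + 1) := ⟨hz, by simp⟩
    refine hasDerivAt_tsum_of_isPreconnected
      ((summable_aux (p := (s + 1).re + (K + 1 : ℕ)) ?_).mul_left (‖s‖ * C)) hV
      ((convex_halfSpace_re_gt 0).inter (convex_ball _ _)).isPreconnected
      (fun n y hy => hasDerivAt_rem (K + 1) n s y (le_of_lt hy.1)) (fun n y hy => ?_) hmem
      (summable_rem _ s z hz.le ?_) hmem
    · push_cast; simp; linarith
    · rw [norm_mul, norm_neg, mul_assoc]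
      have := h n (s + 1) y le_rfl (le_of_lt hy.1) (by simpa using (mem_ball_zero_iff.mp hy.2).le)
      rw [neg_add, ← sub_eq_add_neg]
      gcongr
    · push_cast; linarith
  have hsum : HasDerivAt (fun z : ℂ => ∑ k ∈ Finset.range (K + 1 + 1), zetaCoef k s * z ^ k)
      (-s * ∑ k ∈ Finset.range (K + 1), zetaCoef k (s + 1) * z ^ k) z := by
    simp only [Finset.sum_range_succ' _ (K + 1), pow_zero, Finset.mul_sum]
    refine HasDerivAt.add_const _ (HasDerivAt.fun_sum fun k _ => ?_)
    refine ((hasDerivAt_pow (k + 1) z).const_mul _).congr_deriv ?_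
    have := zetaCoef_shift k hs0
    push_cast
    linear_combination z ^ k * this
  have hpow : HasDerivAt (fun z : ℂ => z ^ (-s)) (-s * z ^ (-s - 1) * 1) z :=
    HasDerivAt.cpow_const (hasDerivAt_id z) hz0
  have htot := (hpow.add hrem).add hsum
  refine (htot.congr_of_eventuallyEq ?_).congr_deriv ?_
  · filter_upwards [(isOpen_lt_re 0).mem_nhds hz] with w hw
    exact hurwitzZetaC_eq_expansion (K + 1) hw hs1 (by push_cast; linarith)
  · rw [hurwitzZetaC_eq_expansion K hz (by simpa using hs0) (by simp; linarith), tsum_mul_left,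
      show -(s + 1) = -s - 1 by ring]
    ring

lemma continuousAt_binomRem (K n : ℕ) {p : ℂ × ℂ} (hp : 0 < p.2.re) :
    ContinuousAt (fun p : ℂ × ℂ => binomRem K n p.1 p.2) p := by
  have hsp : (n : ℂ) + 1 + p.2 ∈ slitPlane := by
    left; simp; positivity
  have hn : (n : ℂ) + 1 ∈ slitPlane := by
    left; simp; positivity
  unfold binomRem
  refine ContinuousAt.sub ?_ (tendsto_finsetSum _ fun k _ => ?_)
  · exact ContinuousAt.cpow (by fun_prop) (by fun_prop) hsp
  · have h1 : ContinuousAt (fun p : ℂ × ℂ => binomCoef k p.1) p :=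
      (differentiable_coef k).continuous.continuousAt.comp continuousAt_fst
    exact (h1.mul (by fun_prop)).mul (ContinuousAt.cpow (by fun_prop) (by fun_prop) hn)

/-- Joint continuity of `ζ(s, z)` in both variables. -/
lemma continuousAt_hurwitzZetaC {p : ℂ × ℂ} (hp1 : p.1 ≠ 1) (hp2 : 0 < p.2.re) :
    ContinuousAt (fun p : ℂ × ℂ => hurwitzZetaC p.1 p.2) p := by
  -- The extra `1` leaves room for a neighbourhood on which the remainder terms are uniformly `O((n
  -- + 1)^(-2))`.
  obtain ⟨K, hK⟩ := exists_nat_gt (-p.1.re + 1)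
  set V : Set (ℂ × ℂ) := ({s : ℂ | -(K : ℝ) + 1 < s.re} ∩ {1}ᶜ ∩ Metric.ball 0 (‖p.1‖ + 1)) ×ˢ
    ({z : ℂ | 0 < z.re} ∩ Metric.ball 0 (‖p.2‖ + 1))
  have hVo : IsOpen V :=
    (((isOpen_lt_re _).inter isOpen_compl_singleton).inter Metric.isOpen_ball).prod
      ((isOpen_lt_re _).inter Metric.isOpen_ball)
  have hpV : p ∈ V := by
    refine ⟨⟨⟨?_, hp1⟩, by simp⟩, hp2, by simp⟩
    change -(K : ℝ) + 1 < p.1.re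
    linarith
  have hVn : V ∈ 𝓝 p := hVo.mem_nhds hpV
  obtain ⟨C, hC, h⟩ := rem_bound (K + 1) (‖p.2‖ + 1) (‖p.1‖ + 1) (by positivity) (by positivity)
  have hts : ContinuousOn (fun p : ℂ × ℂ => ∑' n : ℕ, binomRem (K + 1) n p.1 p.2) V := by
    refine continuousOn_tsum (fun n q hq => (continuousAt_binomRem _ n hq.2.1).continuousWithinAt)
      ((summable_aux (p := 2) (by norm_num)).mul_left C) fun n q hq => ?_
    refine (h n q.1 q.2 (mem_ball_zero_iff.mp hq.1.2).le (le_of_lt hq.2.1)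
      (mem_ball_zero_iff.mp hq.2.2).le).trans ?_
    have : -(K : ℝ) + 1 < q.1.re := hq.1.1.1
    gcongr
    · linarith [n.cast_nonneg (α := ℝ)]
    · push_cast; linarith
  have hsum : ContinuousAt
      (fun p : ℂ × ℂ => ∑ k ∈ Finset.range (K + 1), zetaCoef k p.1 * p.2 ^ k) p := by
    refine tendsto_finsetSum _ fun k _ => ?_
    have h1 : ContinuousAt (fun p : ℂ × ℂ => zetaCoef k p.1) p :=
      (differentiableAt_zetaCoef k hp1).continuousAt.comp continuousAt_fst
    exact h1.mul (by fun_prop)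
  have hpow : ContinuousAt (fun p : ℂ × ℂ => p.2 ^ (-p.1)) p :=
    ContinuousAt.cpow (by fun_prop) (by fun_prop) (Or.inl hp2)
  refine ((hpow.add (hts.continuousAt hVn)).add hsum).congr_of_eventuallyEq ?_
  filter_upwards [hVn] with q hq
  have : -(K : ℝ) + 1 < q.1.re := hq.1.1.1
  exact hurwitzZetaC_eq_expansion K hq.2.1 hq.1.1.2 (by linarith)

/-! ### Exchanging the two derivatives by Cauchy's formula. -/

/-- Differentiation of a circle integral with respect to a parameter. -/
lemma hasDerivAt_circleIntegral {f f' : ℂ → ℂ → ℂ} {k : ℂ → ℂ} {c z₀ : ℂ} {r : ℝ} {V : Set ℂ}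
    (hr : 0 ≤ r) (hV : IsOpen V) (hz₀ : z₀ ∈ V)
    (hk : ContinuousOn k (Metric.sphere c r))
    (hf : ContinuousOn (fun p : ℂ × ℂ => f p.1 p.2) (Metric.sphere c r ×ˢ V))
    (hf' : ContinuousOn (fun p : ℂ × ℂ => f' p.1 p.2) (Metric.sphere c r ×ˢ V))
    (hd : ∀ w ∈ Metric.sphere c r, ∀ z ∈ V, HasDerivAt (f w) (f' w z) z) :
    HasDerivAt (fun z => ∮ w in C(c, r), k w * f w z) (∮ w in C(c, r), k w * f' w z₀) z₀ := by
  obtain ⟨ε, hε, hεV⟩ := Metric.nhds_basis_closedBall.mem_iff.mp (hV.mem_nhds hz₀)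
  have hslice : ∀ {g : ℂ → ℂ → ℂ}, ContinuousOn (fun p : ℂ × ℂ => g p.1 p.2)
      (Metric.sphere c r ×ˢ V) → ∀ z ∈ V, Continuous fun θ : ℝ =>
        deriv (circleMap c r) θ • (k (circleMap c r θ) * g (circleMap c r θ) z) := by
    intro g hg z hz
    have hm : ∀ θ, circleMap c r θ ∈ Metric.sphere c r := circleMap_mem_sphere c hr
    have h1 : Continuous fun θ => k (circleMap c r θ) :=
      hk.comp_continuous (continuous_circleMap c r) hm
    have h2 : Continuous fun θ => g (circleMap c r θ) z :=
      hg.comp_continuous (f := fun θ => (circleMap c r θ, z))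
        ((continuous_circleMap c r).prodMk continuous_const) fun θ => ⟨hm θ, hz⟩
    have h3 : Continuous (deriv (circleMap c r)) := by
      simp only [funext (deriv_circleMap c r)]
      fun_prop
    exact h3.smul (h1.mul h2)
  -- Compactness of the circle times a closed ball supplies a constant dominating function.
  obtain ⟨M, hM⟩ := ((isCompact_sphere c r).prod (isCompact_closedBall z₀ ε)).exists_bound_of_continuousOn
    (f := fun p : ℂ × ℂ => k p.1 * f' p.1 p.2)
    ((hk.comp continuousOn_fst fun p hp => hp.1).mul
      (hf'.mono (prod_mono_right hεV)))
  have := (intervalIntegral.hasDerivAt_integral_of_dominated_loc_of_deriv_le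
    (μ := MeasureTheory.volume) (a := 0) (b := 2 * Real.pi) (x₀ := z₀)
    (F := fun z θ => deriv (circleMap c r) θ • (k (circleMap c r θ) * f (circleMap c r θ) z))
    (F' := fun z θ => deriv (circleMap c r) θ • (k (circleMap c r θ) * f' (circleMap c r θ) z))
    (bound := fun _ => |r| * M)
    (Metric.closedBall_mem_nhds z₀ hε) ?_ ((hslice hf z₀ hz₀).intervalIntegrable _ _)
    (hslice hf' z₀ hz₀).aestronglyMeasurable ?_ (by simp) ?_).2
  · simpa only [circleIntegral] using this
  · filter_upwards [hV.mem_nhds hz₀] with z hz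
    exact (hslice hf z hz).aestronglyMeasurable
  · refine Eventually.of_forall fun θ _ z hz => ?_
    have h1 := hM (circleMap c r θ, z) ⟨circleMap_mem_sphere c hr θ, hz⟩
    rw [norm_smul]
    have h2 : ‖deriv (circleMap c r) θ‖ = |r| := by simp [deriv_circleMap]
    rw [h2]
    exact mul_le_mul_of_nonneg_left h1 (abs_nonneg _)
  · refine Eventually.of_forall fun θ _ z hz => ?_
    have h1 := (hd _ (circleMap_mem_sphere c hr θ) z (hεV hz)).const_mul (k (circleMap c r θ))
    simpa only [smul_eq_mul] using h1.const_mul (deriv (circleMap c r) θ)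

lemma deriv_eq_circleIntegral {f : ℂ → ℂ} {c : ℂ} {r : ℝ} (hr : 0 < r)
    (hf : DifferentiableOn ℂ f (Metric.closedBall c r)) :
    deriv f c = (2 * Real.pi * I)⁻¹ * ∮ w in C(c, r), 1 / (w - c) ^ 2 * f w := by
  have h := (hf.diffContOnCl_ball Subset.rfl).deriv_eq_smul_circleIntegral hr
  simp only [smul_eq_mul] at h
  rw [h, inv_mul_cancel_left₀ two_pi_I_ne_zero]

lemma ne_of_mem_closedBall_neg_nat {n : ℕ} {w b : ℂ} (hb : 1 - (n : ℝ) ≤ b.re)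
    (hw : w ∈ Metric.closedBall (-(n : ℂ)) (1 / 2)) : w ≠ b := by
  rintro rfl
  have h := (abs_re_le_norm _).trans (mem_closedBall_iff_norm.mp hw)
  have h1 := le_of_abs_le h
  simp at h1
  linarith

/-- An integer centre and radius `1/2` keep the circle off the integers, so `ζ(w + 1, z)` has no
pole on it. This covers `n = 0` too, where `0` lies inside the disc. -/
lemma ne_zero_of_mem_sphere_neg_nat {n : ℕ} {w : ℂ}
    (hw : w ∈ Metric.sphere (-(n : ℂ)) (1 / 2)) : w ≠ 0 := by
  rintro rfl
  have h : (n : ℝ) = 1 / 2 := by simpa using hw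
  have h2 : ((2 * n : ℕ) : ℝ) = (1 : ℕ) := by push_cast; linarith
  have := Nat.cast_injective h2
  omega

lemma ne_one_of_mem_closedBall_neg_nat {n : ℕ} {w : ℂ}
    (hw : w ∈ Metric.closedBall (-(n : ℂ)) (1 / 2)) : w ≠ 1 :=
  ne_of_mem_closedBall_neg_nat (by simp) hw

lemma differentiableOn_hurwitzZetaC_closedBall (n : ℕ) {z : ℂ} (hz : 0 < z.re) :
    DifferentiableOn ℂ (fun s => hurwitzZetaC s z) (Metric.closedBall (-(n : ℂ)) (1 / 2)) :=
  (differentiableOn_hurwitzZetaC hz).mono fun _ hw => ne_one_of_mem_closedBall_neg_nat hw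

/-- Only values on the circle enter, so `n = 0` is allowed. That case later provides
differentiability of `ζ'(0, z)`; for larger `n` the integral is evaluated. -/
lemma hasDerivAt_hurwitzZetaCDeriv_circleIntegral (n : ℕ) {z : ℂ} (hz : 0 < z.re) :
    HasDerivAt (fun z => hurwitzZetaCDeriv (-(n : ℂ)) z)
      ((2 * Real.pi * I)⁻¹ * ∮ w in C(-(n : ℂ), 1 / 2),
        1 / (w - (-(n : ℂ))) ^ 2 * (-w * hurwitzZetaC (w + 1) z)) z := by
  have h := (hasDerivAt_circleIntegral (f := hurwitzZetaC) (k := fun w => 1 / (w - (-(n : ℂ))) ^ 2)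
    (f' := fun w z => -w * hurwitzZetaC (w + 1) z) (c := -(n : ℂ)) (r := 1 / 2) (z₀ := z)
    (by norm_num) (isOpen_lt_re 0) hz ?_ ?_ ?_ ?_).const_mul (2 * Real.pi * I)⁻¹
  · refine h.congr_of_eventuallyEq ?_
    filter_upwards [(isOpen_lt_re 0).mem_nhds hz] with y hy
    exact deriv_eq_circleIntegral (by norm_num) (differentiableOn_hurwitzZetaC_closedBall n hy)
  · refine ContinuousOn.div₀ continuousOn_const (by fun_prop) fun w hw => ?_
    refine pow_ne_zero _ (sub_ne_zero.mpr fun h => ?_)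
    rw [h] at hw
    norm_num at hw
  · rintro p ⟨hp1, hp2⟩
    exact (continuousAt_hurwitzZetaC
      (ne_one_of_mem_closedBall_neg_nat (Metric.sphere_subset_closedBall hp1)) hp2).continuousWithinAt
  · rintro p ⟨hp1, hp2⟩
    have h1 : ContinuousAt (fun p : ℂ × ℂ => hurwitzZetaC (p.1 + 1) p.2) p :=
      ContinuousAt.comp (f := fun p : ℂ × ℂ => (p.1 + 1, p.2))
        (continuousAt_hurwitzZetaC (p := (p.1 + 1, p.2))
          (by simpa using ne_zero_of_mem_sphere_neg_nat hp1) hp2) (by fun_prop)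
    exact (continuousAt_fst.neg.mul h1).continuousWithinAt
  · intro w hw y hy
    exact hasDerivAt_hurwitzZetaC hy (ne_zero_of_mem_sphere_neg_nat hw)
      (ne_one_of_mem_closedBall_neg_nat (Metric.sphere_subset_closedBall hw))

/-- `∂ζ'(-n, z)/∂z` for `n ≥ 1`. -/
lemma hasDerivAt_hurwitzZetaCDeriv (n : ℕ) {z : ℂ} (hz : 0 < z.re) :
    HasDerivAt (fun z => hurwitzZetaCDeriv (-((n + 1 : ℕ) : ℂ)) z)
      (-hurwitzZetaC (-(n : ℂ)) z + (n + 1) * hurwitzZetaCDeriv (-(n : ℂ)) z) z := by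
  refine (hasDerivAt_hurwitzZetaCDeriv_circleIntegral (n + 1) hz).congr_deriv ?_
  have hd : ∀ w, w ≠ 0 → HasDerivAt (fun w => -w * hurwitzZetaC (w + 1) z)
      (-1 * hurwitzZetaC (w + 1) z + -w * hurwitzZetaCDeriv (w + 1) z) w := by
    intro w hw
    have h1 := (differentiableAt_hurwitzZetaC hz (s := w + 1) (by simpa using hw)).hasDerivAt
    exact (hasDerivAt_id w).neg.mul (h1.comp_add_const w 1)
  -- Cauchy's formula read backwards: the centre is at most `-1`, so the closed disc misses the
  -- singular point `w = 0`.
  rw [← deriv_eq_circleIntegral (f := fun w => -w * hurwitzZetaC (w + 1) z) (by norm_num)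
    fun w hw => (hd w (ne_of_mem_closedBall_neg_nat (by simp) hw)).differentiableAt.differentiableWithinAt]
  have hne : -((n + 1 : ℕ) : ℂ) ≠ 0 := neg_ne_zero.mpr (by exact_mod_cast Nat.succ_ne_zero n)
  rw [(hd _ hne).deriv, show -((n + 1 : ℕ) : ℂ) + 1 = -(n : ℂ) by push_cast; ring]
  push_cast
  ring

/-! ### Behaviour at `s = 0` and Lerch's formula. -/

lemma binomRem_two (n : ℕ) (s z : ℂ) :
    binomRem 2 n s z =
      ((n : ℂ) + 1 + z) ^ (-s) - (((n : ℂ) + 1) ^ (-s) + -s * z * ((n : ℂ) + 1) ^ (-s - 1)) := by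
  simp [binomRem, Finset.sum_range_succ, binomCoef]

lemma hurwitzZetaC_eq_linear_expansion {s z : ℂ} (hz : 0 < z.re) (hs1 : s ≠ 1) (hs : -1 < s.re) :
    hurwitzZetaC s z = z ^ (-s) + ∑' n : ℕ, binomRem 2 n s z
      + (riemannZeta s - riemannZeta₁ (s + 1) * z) := by
  rw [hurwitzZetaC_eq_expansion 1 hz hs1 (by simpa using hs)]
  simp [Finset.sum_range_succ, zetaCoef, binomCoef]
  ring

/-- Every remainder term vanishes at `s = 0`, leaving `1 + ζ(0) - z`. -/
lemma hurwitzZetaC_zero {z : ℂ} (hz : 0 < z.re) : hurwitzZetaC 0 z = 1 / 2 - z := by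
  rw [hurwitzZetaC_eq_linear_expansion hz (by simp) (by simp)]
  simp [binomRem_two, riemannZeta_zero]
  ring

lemma hasDerivAt_binomRem_two_zero (n : ℕ) {z : ℂ} (hz : 0 < z.re) :
    HasDerivAt (fun s => binomRem 2 n s z)
      (-log ((n : ℂ) + 1 + z) + log ((n : ℂ) + 1) + z * ((n : ℂ) + 1)⁻¹) 0 := by
  have h1 : (n : ℂ) + 1 + z ≠ 0 := by
    intro h
    have := congrArg re h
    simp at this
    linarith [n.cast_nonneg (α := ℝ)]
  have h2 : (n : ℂ) + 1 ≠ 0 := by exact_mod_cast Nat.succ_ne_zero n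
  have d1 := (hasDerivAt_id (0 : ℂ)).neg.const_cpow (c := (n : ℂ) + 1 + z) (Or.inl h1)
  have d2 := (hasDerivAt_id (0 : ℂ)).neg.const_cpow (c := (n : ℂ) + 1) (Or.inl h2)
  have d3 := ((hasDerivAt_id (0 : ℂ)).neg.sub_const 1).const_cpow (c := (n : ℂ) + 1) (Or.inl h2)
  have d := d1.sub (d2.add (((hasDerivAt_id (0 : ℂ)).neg.mul_const z).mul d3))
  refine (d.congr_of_eventuallyEq (Eventually.of_forall fun s => binomRem_two n s z)).congr_deriv ?_
  simp [cpow_neg_one]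
  ring

/-- Termwise differentiation of the linear expansion at `s = 0` produces the logarithms of the
factors in the Weierstrass product for `Γ`. Euler's constant enters as the derivative of `(s - 1)
ζ(s)` at `1`. -/
lemma hasSum_hurwitzZetaCDeriv_zero {z : ℂ} (hz : 0 < z.re) :
    HasSum (fun n : ℕ => -log ((n : ℂ) + 1 + z) + log ((n : ℂ) + 1) + z * ((n : ℂ) + 1)⁻¹)
      (hurwitzZetaCDeriv 0 z + log z - deriv riemannZeta 0 + Real.eulerMascheroniConstant * z) := by
  have hz0 : z ≠ 0 := by rintro rfl; simp at hz
  -- On the disc of radius `1/2` the second-order remainder decays with exponent at most `-3/2`,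
  -- which is summable.
  obtain ⟨C, hC, h⟩ := rem_bound 2 ‖z‖ (1 / 2) (norm_nonneg _) (by norm_num)
  have hre : ∀ s ∈ Metric.ball (0 : ℂ) (1 / 2), -(1 / 2) < s.re := fun s hs =>
    neg_lt_of_abs_lt ((abs_re_le_norm s).trans_lt (mem_ball_zero_iff.mp hs))
  have hu : Summable fun n : ℕ => C * ((n : ℝ) + 1) ^ (-(3 / 2 : ℝ)) :=
    (summable_aux (by norm_num)).mul_left C
  have hd : ∀ n : ℕ, DifferentiableOn ℂ (fun s => binomRem 2 n s z) (Metric.ball 0 (1 / 2)) :=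
    fun n => (differentiable_rem 2 n z hz.le).differentiableOn
  have hle : ∀ (n : ℕ) (s : ℂ), s ∈ Metric.ball (0 : ℂ) (1 / 2) →
      ‖binomRem 2 n s z‖ ≤ C * ((n : ℝ) + 1) ^ (-(3 / 2 : ℝ)) := by
    intro n s hs
    refine (h n s z (mem_ball_zero_iff.mp hs).le hz.le le_rfl).trans ?_
    have := hre s hs
    gcongr
    · linarith [n.cast_nonneg (α := ℝ)]
    · push_cast; linarith
  have h0 : (0 : ℂ) ∈ Metric.ball (0 : ℂ) (1 / 2) := by simp
  have key := hasSum_deriv_of_summable_norm hu hd Metric.isOpen_ball hle h0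
  simp only [(hasDerivAt_binomRem_two_zero _ hz).deriv] at key
  have hts : HasDerivAt (fun s => ∑' n : ℕ, binomRem 2 n s z) _ 0 :=
    ((differentiableOn_tsum_of_summable_norm hu hd Metric.isOpen_ball hle).differentiableAt
      (Metric.isOpen_ball.mem_nhds h0)).hasDerivAt
  have hpow := (hasDerivAt_id (0 : ℂ)).neg.const_cpow (c := z) (Or.inl hz0)
  have hz1 : HasDerivAt (fun s => riemannZeta₁ (s + 1)) (Real.eulerMascheroniConstant : ℂ) 0 := by
    have h1 := (differentiable_riemannZeta₁ (0 + 1)).hasDerivAt.comp_add_const 0 1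
    simpa only [zero_add, deriv_riemannZeta₁_one] using h1
  have hzR := (differentiableAt_riemannZeta (show (0 : ℂ) ≠ 1 by simp)).hasDerivAt
  have htot := ((hpow.add hts).add (hzR.sub (hz1.mul_const z))).congr_of_eventuallyEq
    (f₁ := fun s => hurwitzZetaC s z) (by
      filter_upwards [Metric.isOpen_ball.mem_nhds h0] with s hs
      refine hurwitzZetaC_eq_linear_expansion hz ?_ (by linarith [hre s hs])
      rintro rfl
      norm_num at hs)
  have hval : hurwitzZetaCDeriv 0 z + log z - deriv riemannZeta 0
      + Real.eulerMascheroniConstant * z = deriv (fun w => ∑' n : ℕ, binomRem 2 n w z) 0 := by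
    rw [hurwitzZetaCDeriv, htot.deriv]
    simp
    ring
  rwa [hval]

/-- Compares partial Weierstrass products with Euler's sequence. The discrepancy involves only `H_N
- log N - γ`, which tends to `0`. -/
lemma prod_exp_eq_GammaSeq {z : ℂ} (hz : 0 < z.re) {N : ℕ} (hN : N ≠ 0) :
    exp (-log z - Real.eulerMascheroniConstant * z + ∑ n ∈ Finset.range N,
        (-log ((n : ℂ) + 1 + z) + log ((n : ℂ) + 1) + z * ((n : ℂ) + 1)⁻¹))
      = GammaSeq z N * exp (z * ((((harmonic N : ℚ) : ℝ) - Real.log N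
        - Real.eulerMascheroniConstant : ℝ) : ℂ)) := by
  have hz0 : z ≠ 0 := by rintro rfl; simp at hz
  have hzn : ∀ n : ℕ, (n : ℂ) + 1 + z ≠ 0 := by
    intro n h
    have := congrArg re h
    simp at this
    linarith [n.cast_nonneg (α := ℝ)]
  have hn : ∀ n : ℕ, (n : ℂ) + 1 ≠ 0 := fun n => by exact_mod_cast Nat.succ_ne_zero n
  have hN' : (N : ℂ) ≠ 0 := by exact_mod_cast hN
  have hfac : ∏ n ∈ Finset.range N, ((n : ℂ) + 1) = (N.factorial : ℂ) := by
    rw [← Finset.prod_range_add_one_eq_factorial]; push_cast; rfl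
  have hharm : ∑ n ∈ Finset.range N, ((n : ℂ) + 1)⁻¹ = (((harmonic N : ℚ) : ℝ) : ℂ) := by
    simp [harmonic]
  have hexp : ∀ n ∈ Finset.range N, exp (-log ((n : ℂ) + 1 + z) + log ((n : ℂ) + 1))
      = ((n : ℂ) + 1) / (z + (n + 1 : ℕ)) := by
    intro n _
    rw [exp_add, exp_neg, exp_log (hzn n), exp_log (hn n)]
    push_cast
    rw [div_eq_inv_mul, show z + ((n : ℂ) + 1) = (n : ℂ) + 1 + z by ring]
  rw [Finset.sum_add_distrib, ← Finset.mul_sum, hharm]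
  have e : -log z - Real.eulerMascheroniConstant * z
      + (∑ n ∈ Finset.range N, (-log ((n : ℂ) + 1 + z) + log ((n : ℂ) + 1))
        + z * (((harmonic N : ℚ) : ℝ) : ℂ))
      = (-log z + log N * z + ∑ n ∈ Finset.range N, (-log ((n : ℂ) + 1 + z) + log ((n : ℂ) + 1)))
        + z * ((((harmonic N : ℚ) : ℝ) - Real.log N - Real.eulerMascheroniConstant : ℝ) : ℂ) := by
    push_cast
    ring
  rw [e, exp_add]
  congr 1
  rw [exp_add, exp_add, exp_neg, exp_log hz0, exp_sum, Finset.prod_congr rfl hexp,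
    Finset.prod_div_distrib, hfac, GammaSeq, Finset.prod_range_succ', cpow_def_of_ne_zero hN']
  simp only [Nat.cast_zero, add_zero]
  rw [div_eq_mul_inv, div_eq_mul_inv, mul_inv]
  ring

/-- Lerch's formula, up to the choice of the logarithm. -/
lemma exp_hurwitzZetaCDeriv_zero {z : ℂ} (hz : 0 < z.re) :
    exp (hurwitzZetaCDeriv 0 z - deriv riemannZeta 0) = Gamma z := by
  have h1 := ((hasSum_hurwitzZetaCDeriv_zero hz).tendsto_sum_nat.const_add
    (-log z - Real.eulerMascheroniConstant * z)).cexp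
  have h2 : Tendsto (fun N : ℕ => GammaSeq z N * exp (z * ((((harmonic N : ℚ) : ℝ) - Real.log N
        - Real.eulerMascheroniConstant : ℝ) : ℂ))) atTop (𝓝 (Gamma z)) := by
    have h3 : Tendsto (fun N : ℕ => (((harmonic N : ℚ) : ℝ) - Real.log N
        - Real.eulerMascheroniConstant : ℝ)) atTop (𝓝 0) := by
      simpa using Real.tendsto_harmonic_sub_log.sub_const Real.eulerMascheroniConstant
    have h4 := (((continuous_ofReal.tendsto _).comp h3).const_mul z).cexp
    simpa using (GammaSeq_tendsto_Gamma z).mul h4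
  have h5 := h2.congr' (f₂ := fun N : ℕ => exp (-log z - Real.eulerMascheroniConstant * z
      + ∑ n ∈ Finset.range N,
        (-log ((n : ℂ) + 1 + z) + log ((n : ℂ) + 1) + z * ((n : ℂ) + 1)⁻¹))) (by
    filter_upwards [eventually_ne_atTop 0] with N hN
    exact (prod_exp_eq_GammaSeq hz hN).symm)
  rw [← tendsto_nhds_unique h1 h5]
  congr 1
  ring

/-- The logarithmic derivative of the exponential identity, which removes the ambiguity in the
branch of the logarithm. -/
lemma hasDerivAt_hurwitzZetaCDeriv_zero {z : ℂ} (hz : 0 < z.re) :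
    HasDerivAt (fun z => hurwitzZetaCDeriv 0 z) (digamma z) z := by
  have hd : DifferentiableAt ℂ (fun z => hurwitzZetaCDeriv 0 z) z := by
    simpa using (hasDerivAt_hurwitzZetaCDeriv_circleIntegral 0 hz).differentiableAt
  have h1 := (hd.hasDerivAt.sub_const (deriv riemannZeta 0)).cexp
  have h2 := h1.congr_of_eventuallyEq (f₁ := Gamma) (by
    filter_upwards [(isOpen_lt_re 0).mem_nhds hz] with w hw
    exact (exp_hurwitzZetaCDeriv_zero hw).symm)
  refine hd.hasDerivAt.congr_deriv ?_
  rw [exp_hurwitzZetaCDeriv_zero hz] at h2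
  rw [digamma_def, logDeriv_apply, h2.deriv, mul_div_cancel_left₀ _ (Gamma_ne_zero_of_re_pos hz)]

lemma hurwitzZetaCDeriv_one_right {s : ℂ} (hs : s ≠ 1) :
    hurwitzZetaCDeriv s 1 = deriv riemannZeta s := by
  refine EventuallyEq.deriv_eq ?_
  filter_upwards [isOpen_compl_singleton.mem_nhds hs] with w hw
  exact hurwitzZetaC_one_right hw

/-! ### Segment integrals and the branch of `log Γ`. -/

lemma segmentIntegral_eq_sub {f F : ℂ → ℂ} {t : ℂ}
    (hf : ContinuousOn (fun u : ℝ => f (u * t)) (uIcc 0 1))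
    (hF : ∀ u ∈ uIcc (0 : ℝ) 1, HasDerivAt F (f (u * t)) (u * t)) :
    segmentIntegral f t = F t - F 0 := by
  have h := intervalIntegral.integral_eq_sub_of_hasDerivAt (a := 0) (b := 1)
    (f := fun u : ℝ => F (u * t)) (f' := fun u : ℝ => f (u * t) * t) (fun u hu => ?_)
    (hf.mul continuousOn_const).intervalIntegrable
  · simpa [segmentIntegral] using h
  · have h1 : HasDerivAt (fun u : ℝ => (u : ℂ) * t) t u := by
      simpa using (ofRealCLM.hasDerivAt (x := u)).mul_const t
    exact (hF u hu).comp u h1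

lemma continuousAt_digamma {z : ℂ} (hz : 0 < z.re) : ContinuousAt digamma z := by
  have h : AnalyticAt ℂ Gamma z := by
    refine DifferentiableOn.analyticAt (s := {z : ℂ | 0 < z.re}) (fun w hw => ?_)
      ((isOpen_lt_re 0).mem_nhds hz)
    refine (differentiableAt_Gamma w fun m hm => ?_).differentiableWithinAt
    have hw : 0 < w.re := hw
    rw [hm] at hw
    simp at hw
    linarith [m.cast_nonneg (α := ℝ)]
  exact h.deriv.continuousAt.div h.continuousAt (Gamma_ne_zero_of_re_pos hz)

/-- Lerch's formula `ζ'(0, z) = log Γ(z) - log √(2π)`. -/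
lemma logGamma_eq {z : ℂ} (hz : 0 < z.re) :
    logGamma z = hurwitzZetaCDeriv 0 z + Real.log (Real.sqrt (2 * Real.pi)) := by
  have hpos : ∀ u ∈ uIcc (0 : ℝ) 1, 0 < (1 + (u : ℂ) * (z - 1)).re := by
    intro u hu
    rw [uIcc_of_le zero_le_one] at hu
    have e : (1 + (u : ℂ) * (z - 1)).re = (1 - u) + u * z.re := by simp; ring
    rw [e]
    rcases hu.2.eq_or_lt with rfl | h
    · simpa using hz
    · have := mul_nonneg hu.1 hz.le
      linarith
  have h := segmentIntegral_eq_sub (f := fun s => digamma (1 + s))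
    (F := fun s => hurwitzZetaCDeriv 0 (1 + s)) (t := z - 1)
    (fun u hu => (ContinuousAt.comp (f := fun u : ℝ => 1 + (u : ℂ) * (z - 1))
      (continuousAt_digamma (hpos u hu)) (by fun_prop)).continuousWithinAt)
    (fun u hu => (hasDerivAt_hurwitzZetaCDeriv_zero (hpos u hu)).comp_const_add 1 _)
  have e : logGamma z = segmentIntegral (fun s => digamma (1 + s)) (z - 1) := rfl
  -- The constant of integration is read off at `z = 1`, from `ζ'(0) = -log(2π)/2`.
  rw [e, h, add_sub_cancel, add_zero, hurwitzZetaCDeriv_one_right (by simp),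
    deriv_riemannZeta_zero, Real.log_sqrt (by positivity)]
  have : log (2 * Real.pi) = (Real.log (2 * Real.pi) : ℂ) := by
    rw [ofReal_log (by positivity)]; push_cast; rfl
  rw [this]
  push_cast
  ring

/-! ### The ladder of functions `g` and the telescoping sum. -/

lemma gFun_zero {z : ℂ} (hz : 0 < z.re) :
    gFun 0 z = logGamma z - Real.log (Real.sqrt (2 * Real.pi))
      - Real.eulerMascheroniConstant * (1 / 2 - z) := by
  rw [gFun, logGamma_eq hz]
  simp [hurwitzZetaC_zero hz, digamma_one]
  ring

/-- The digamma recurrence contributes `(k+1) · 1/(k+1) · ζ(-k, z)`, which cancels the `-ζ(-k, z)`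
coming from the derivative of `ζ'(-(k+1), z)`. -/
lemma hasDerivAt_gFun (k : ℕ) {z : ℂ} (hz : 0 < z.re) :
    HasDerivAt (gFun (k + 1)) ((k + 1) * gFun k z) z := by
  have hk : ((k : ℂ) + 1) ≠ 0 := by exact_mod_cast Nat.succ_ne_zero k
  have hne1 : -((k + 1 : ℕ) : ℂ) ≠ 1 := by
    intro h
    have := congrArg re h
    simp at this
    linarith [k.cast_nonneg (α := ℝ)]
  have h1 := hasDerivAt_hurwitzZetaC hz (s := -((k + 1 : ℕ) : ℂ))
    (neg_ne_zero.mpr (by exact_mod_cast Nat.succ_ne_zero k)) hne1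
  rw [show -((k + 1 : ℕ) : ℂ) + 1 = -(k : ℂ) by push_cast; ring] at h1
  have h2 := digamma_apply_add_one ((k : ℂ) + 1) (fun m h => by
    have := congrArg re h
    simp at this
    linarith [k.cast_nonneg (α := ℝ), m.cast_nonneg (α := ℝ)])
  refine ((hasDerivAt_hurwitzZetaCDeriv k hz).add
    (h1.const_mul (digamma (((k + 1 : ℕ) : ℂ) + 1)))).congr_deriv ?_
  rw [gFun]
  push_cast
  rw [h2]
  field_simp
  ring

lemma hasDerivAt_sum_gFun (m : ℕ) {a t : ℂ} (hz : 0 < (a + t).re) :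
    HasDerivAt (fun t => ∑ k ∈ Finset.range (m + 1),
        ((-1 : ℂ) ^ k / ((k : ℂ) + 1)) * (m.choose k : ℂ) * t ^ (m - k) * gFun (k + 1) (a + t))
      (t ^ m * gFun 0 (a + t)) t := by
  have h : ∀ k ∈ Finset.range (m + 1), HasDerivAt (fun t =>
      ((-1 : ℂ) ^ k / ((k : ℂ) + 1)) * (m.choose k : ℂ) * t ^ (m - k) * gFun (k + 1) (a + t))
      ((-1) ^ k * (m.choose k : ℂ) * t ^ (m - k) * gFun k (a + t)
        - (-1) ^ (k + 1) * (m.choose (k + 1) : ℂ) * t ^ (m - (k + 1)) * gFun (k + 1) (a + t)) t := by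
    intro k hk
    have hk0 : ((k : ℂ) + 1) ≠ 0 := by exact_mod_cast Nat.succ_ne_zero k
    -- This identity turns the term from differentiating `t^(m-k)` into the next member of the
    -- telescoping sequence.
    have hc : (m.choose (k + 1) : ℂ) * ((k : ℂ) + 1) = m.choose k * ((m - k : ℕ) : ℂ) := by
      exact_mod_cast Nat.choose_succ_right_eq m k
    refine (((hasDerivAt_pow (m - k) t).const_mul _).mul
      ((hasDerivAt_gFun k hz).comp_const_add a t)).congr_deriv ?_
    rw [Nat.sub_add_eq]
    generalize gFun (k + 1) (a + t) = y
    field_simp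
    linear_combination (-(-1) ^ k * t ^ (m - k - 1) * y) * hc
  refine (HasDerivAt.fun_sum h).congr_deriv ?_
  -- The upper boundary term, at `k = m + 1`, vanishes with its binomial coefficient; the lower one
  -- is the desired derivative.
  rw [Finset.sum_range_sub' fun k : ℕ =>
    (-1 : ℂ) ^ k * (m.choose k : ℂ) * t ^ (m - k) * gFun k (a + t)]
  simp

/-! ### Primitives of the integrands and conclusion. -/

lemma continuousAt_logGamma {z : ℂ} (hz : 0 < z.re) : ContinuousAt logGamma z := by
  refine ((hasDerivAt_hurwitzZetaCDeriv_zero hz).continuousAt.add_const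
    (Real.log (Real.sqrt (2 * Real.pi)) : ℂ)).congr ?_
  filter_upwards [(isOpen_lt_re 0).mem_nhds hz] with w hw
  exact (logGamma_eq hw).symm

lemma re_add_segment_pos {a t : ℂ} (ht : ‖t‖ < a.re) {u : ℝ} (hu : u ∈ uIcc (0 : ℝ) 1) :
    0 < (a + (u : ℂ) * t).re := by
  rw [uIcc_of_le zero_le_one] at hu
  have h1 : ‖(u : ℂ) * t‖ ≤ ‖t‖ := by
    rw [norm_mul, norm_real, Real.norm_of_nonneg hu.1]
    exact mul_le_of_le_one_left (norm_nonneg _) hu.2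
  have h2 := neg_le_of_abs_le (abs_re_le_norm ((u : ℂ) * t))
  rw [add_re]
  linarith

lemma continuousOn_logGamma_segment {a t : ℂ} (ht : ‖t‖ < a.re) :
    ContinuousOn (fun u : ℝ => logGamma (a + (u : ℂ) * t)) (uIcc 0 1) := fun u hu =>
  (ContinuousAt.comp (f := fun u : ℝ => a + (u : ℂ) * t)
    (continuousAt_logGamma (re_add_segment_pos ht hu)) (by fun_prop)).continuousWithinAt

lemma hasDerivAt_moment_primitive (m : ℕ) {a t : ℂ} (hz : 0 < (a + t).re) :
    HasDerivAt (fun t => -(Real.eulerMascheroniConstant : ℂ) * (t ^ (m + 2) / ((m : ℂ) + 2))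
          + ((Real.log (Real.sqrt (2 * Real.pi)) : ℂ)
              - (Real.eulerMascheroniConstant : ℂ) * (a - 1 / 2)) * (t ^ (m + 1) / ((m : ℂ) + 1))
          + ∑ k ∈ Finset.range (m + 1),
              ((-1 : ℂ) ^ k / ((k : ℂ) + 1)) * (m.choose k : ℂ) * t ^ (m - k) * gFun (k + 1) (a + t))
      (t ^ m * logGamma (a + t)) t := by
  have h1 : ((m : ℂ) + 1) ≠ 0 := by exact_mod_cast Nat.succ_ne_zero m
  have h2 : ((m : ℂ) + 2) ≠ 0 := by exact_mod_cast Nat.succ_ne_zero (m + 1)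
  refine (((((hasDerivAt_pow (m + 2) t).div_const ((m : ℂ) + 2)).const_mul _).add
    (((hasDerivAt_pow (m + 1) t).div_const ((m : ℂ) + 1)).const_mul _)).add
    (hasDerivAt_sum_gFun m hz)).congr_deriv ?_
  rw [gFun_zero hz]
  simp only [Nat.add_succ_sub_one]
  push_cast
  rw [mul_div_cancel_left₀ _ h1, mul_div_cancel_left₀ _ h2]
  ring

/-- The derivative of `ζ'(-1, a+t)` is `ζ'(0, a+t) + (a + t - 1/2)`. The polynomial absorbs the
affine part and supplies Lerch's constant, so `g` and `γ` are not needed. -/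
lemma hasDerivAt_logGamma_primitive {a t : ℂ} (hz : 0 < (a + t).re) :
    HasDerivAt (fun t => -(t ^ 2 / 2) + ((Real.log (Real.sqrt (2 * Real.pi)) : ℂ) - a + 1 / 2) * t
        + hurwitzZetaCDeriv (-1) (a + t)) (logGamma (a + t)) t := by
  have h := (hasDerivAt_hurwitzZetaCDeriv 0 hz).comp_const_add a t
  simp only [zero_add, Nat.cast_one, Nat.cast_zero, neg_zero, hurwitzZetaC_zero hz] at h
  refine (((((hasDerivAt_pow 2 t).div_const 2).neg).add
    ((hasDerivAt_id t).const_mul _)).add h).congr_deriv ?_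
  rw [logGamma_eq hz]
  push_cast
  ring

end HurwitzContinuation

theorem theorem4 (a t : ℂ) (ha : 0 < a.re) (ht : ‖t‖ < a.re) :
    (∀ m : ℕ,
      IntervalIntegrable
        (fun u : ℝ => (((u : ℂ) * t) ^ m * logGamma (a + (u : ℂ) * t)) * t)
        MeasureTheory.volume 0 1 ∧
      segmentIntegral (fun s => s ^ m * logGamma (a + s)) t =
        -(Real.eulerMascheroniConstant : ℂ) * (t ^ (m + 2) / ((m : ℂ) + 2))
          + ((Real.log (Real.sqrt (2 * Real.pi)) : ℂ)
              - (Real.eulerMascheroniConstant : ℂ) * (a - 1 / 2)) * (t ^ (m + 1) / ((m : ℂ) + 1))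
          + ∑ k ∈ Finset.range (m + 1),
              ((-1 : ℂ) ^ k / ((k : ℂ) + 1)) * (m.choose k : ℂ) * t ^ (m - k) * gFun (k + 1) (a + t)
          - ((-1 : ℂ) ^ m / ((m : ℂ) + 1)) * gFun (m + 1) a) ∧
    segmentIntegral (fun s => logGamma (a + s)) t =
      -(t ^ 2 / 2) + ((Real.log (Real.sqrt (2 * Real.pi)) : ℂ) - a + 1 / 2) * t
        + hurwitzZetaCDeriv (-1) (a + t) - hurwitzZetaCDeriv (-1) a := by
  have hlog := HurwitzContinuation.continuousOn_logGamma_segment ht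
  refine ⟨fun m => ?_, ?_⟩
  · have hcont : ContinuousOn (fun u : ℝ => ((u : ℂ) * t) ^ m * logGamma (a + (u : ℂ) * t))
        (Set.uIcc 0 1) := ContinuousOn.mul (by fun_prop) hlog
    refine ⟨(hcont.mul continuousOn_const).intervalIntegrable, ?_⟩
    rw [HurwitzContinuation.segmentIntegral_eq_sub hcont fun u hu =>
      HurwitzContinuation.hasDerivAt_moment_primitive m
        (HurwitzContinuation.re_add_segment_pos ht hu)]
    congr 1
    -- At the endpoint `0` only `k = m` survives, through `0^0 = 1`; it gives the subtracted term
    -- `g(m+1, a)`.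
    rw [Finset.sum_range_succ, Finset.sum_eq_zero fun k hk => by
      rw [zero_pow (Nat.sub_ne_zero_of_lt (Finset.mem_range.mp hk))]; ring]
    simp
  · rw [HurwitzContinuation.segmentIntegral_eq_sub hlog fun u hu =>
      HurwitzContinuation.hasDerivAt_logGamma_primitive
        (HurwitzContinuation.re_add_segment_pos ht hu)]
    simp
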